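/- **Conventions.** Let $\sigma(z)=\max\{0,z\}$. A (ReLU) neural network of depth $L\ge 1$ with input dimension $d\ge 1$ is a function $\mathcal N:\mathbb R^d\to\mathbb R$ computed by $h^{(0)}=x$, $h^{(i)}=\sigma(W^{(i)}h^{(i-1)}+b^{(i)})$ for $1\le i\le L-1$ (with $W^{(i)}\in\mathbb R^{n_i\times n_{i-1}}$, $b^{(i)}\in\mathbb R^{n_i}$, $n_0=d$, and $\sigma$ applied coordinatewise), and $\mathcal N(x)=W^{(L)}h^{(L-1)}+b^{(L)}$ with $W^{(L)}\in\mathbb R^{1\times n_{L-1}}$, $b^{(L)}\in\mathbb R$. Its width is $\max\{d,n_1,\dots,n_{L-1}\}$, and its number of parameters is the total number of entries, zero or not, of all $W^{(i)}$ and $b^{(i)}$. **Theorem.** There is an absolute constant $C>0$ such that the following holds. Let $A,B,n,L,d\ge 1$ be integers and $\epsilon,\delta,\beta>0$. Let $\mathcal N_0$ be a neural network with input dimension $d$, width $n$ and depth $L$, all of whose weights and biases lie in $[-B,B]$. Let $\mathcal D$ be a probability distribution over $[-A,A]^d$ that has a density $p_{\mathcal D}$ with respect to Lebesgue measure such that $p_{\mathcal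 D}(x)\le\beta$ for all $x\in[-A,A]^d$. Put $$\Lambda=\log_2\!\left(\frac{ABn}{\min\{\epsilon,1/2\}}\right),$$ so that $\Lambda=\log_2(ABn\,\epsilon^{-1})$ whenever $\epsilon\le 1/2$. Then there is a neural network $\mathcal N$ with input dimension $d$, width exactly $\max\{d+2,10\}$ and depth at most $C\,n^2L^2\Lambda$ such that $$\Pr_{x\sim\mathcal D}\bigl[\,|\mathcal N(x)-\mathcal N_0(x)|\le\epsilon\,\bigr]>1-\delta ,$$ and the number of parameters of $\mathcal N$ is at most $C\,d\,n^2L^2\Lambda^2$. If moreover $n\ge d^{1.5}$, then the number of parameters of this same $\mathcal N$ is at most $C\,n^2L^2\Lambda^2$. -/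

import Mathlib

open MeasureTheory

/-- The ReLU activation `z ↦ max {0, z}`. -/
noncomputable def relu (z : ℝ) : ℝ := max 0 z

/-- Fully connected ReLU networks with real output and input dimension `d`, listed from the input
side: either the final affine layer `x ↦ W x + b` with one output (no activation), or a hidden
layer `x ↦ σ (W x + b)` with `m` neurons followed by a network with input dimension `m`. -/
inductive ReLUNetwork : ℕ → Type
  | output {d : ℕ} (W : Matrix (Fin 1) (Fin d) ℝ) (b : Fin 1 → ℝ) : ReLUNetwork d
  | hidden {d m : ℕ} (W : Matrix (Fin m) (Fin d) ℝ) (b : Fin m → ℝ) (N : ReLUNetwork m) :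
      ReLUNetwork d

namespace ReLUNetwork

/-- The function `ℝ^d → ℝ` computed by the network. -/
noncomputable def eval : {d : ℕ} → ReLUNetwork d → (Fin d → ℝ) → ℝ
  | _, output W b, x => (W.mulVec x + b) 0
  | _, hidden W b N, x => N.eval (fun i => relu ((W.mulVec x + b) i))

/-- The number of layers, counting the output layer but not the input. -/
def depth : {d : ℕ} → ReLUNetwork d → ℕ
  | _, output _ _ => 1
  | _, hidden _ _ N => N.depth + 1

/-- The maximum of the input dimension and of the numbers of neurons of the hidden layers. -/
def width : {d : ℕ} → ReLUNetwork d → ℕ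
  | d, output _ _ => d
  | d, hidden _ _ N => max d N.width

/-- The total number of entries (zero or not) of all weight matrices and bias vectors. -/
def numParams : {d : ℕ} → ReLUNetwork d → ℕ
  | d, output _ _ => 1 * d + 1
  | d, hidden (m := m) _ _ N => (m * d + m) + N.numParams

/-- All entries of all weight matrices and bias vectors lie in `[-B, B]`. -/
def WeightsBoundedBy (B : ℝ) : {d : ℕ} → ReLUNetwork d → Prop
  | _, output W b => (∀ i j, |W i j| ≤ B) ∧ (∀ i, |b i| ≤ B)
  | _, hidden W b N => (∀ i j, |W i j| ≤ B) ∧ (∀ i, |b i| ≤ B) ∧ N.WeightsBoundedBy B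

end ReLUNetwork

/-- The cube `[-A, A]^d`. -/
def cube (d : ℕ) (A : ℝ) : Set (Fin d → ℝ) := {x | ∀ i, x i ∈ Set.Icc (-A) A}

/-- `D` is a probability distribution over `[-A, A]^d` that has a density `p` with respect to
Lebesgue measure on the cube, and `p ≤ β` on the cube. -/
def HasDensityBoundedBy {d : ℕ} (D : Measure (Fin d → ℝ)) (A β : ℝ) : Prop :=
  IsProbabilityMeasure D ∧
    ∃ p : (Fin d → ℝ) → ℝ, Measurable p ∧ (∀ x ∈ cube d A, 0 ≤ p x ∧ p x ≤ β) ∧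
      D = (volume.restrict (cube d A)).withDensity (fun x => ENNReal.ofReal (p x))

open Filter

/-! Round the inputs and all hidden values to multiples of a small mesh. Since the network is
Lipschitz, the errors add up to at most a multiple of `(2nB)^L` times the mesh, so `k = O(LΛ)` bits
per value suffice. A layer then consists of at most `n` digits in base `2 ^ k`, which are packed
into one real number. A machine with five registers simulates the network neuron by neuron
(`exists_realizable_of_network`): threshold steps peel off the bits one at a time
(`exists_circuit_extract`), accumulate the weighted sum and round the result. This takes `O(n²k)`
steps per layer.

A threshold is discontinuous, but at each fixed `s` the difference `relu (m * s + 1) - relu (m * s)`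
equals the Heaviside function exactly for all large `m`, even at `s = 0`. A step on `w` registers
therefore becomes two ReLU layers of width at most `w + 2`, and a finite circuit is reproduced
exactly at each given point once `m` is large. Pointwise success on the cube gives success with
probability above `1 - δ` for some `m` (`eventually_lt_measureReal_of_ae_eventually`).

Only packing the `d` inputs needs width `d + 2`. It takes at most `dk` steps of `O(d²)` parameters
each. The resulting `d³k` is at most `dn²k`, and at most `n²k` when `n ≥ d^{1.5}`. -/

theorem relu_nonneg (z : ℝ) : 0 ≤ relu z := le_max_left _ _

theorem relu_of_nonneg {z : ℝ} (h : 0 ≤ z) : relu z = z := max_eq_right h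

theorem relu_of_nonpos {z : ℝ} (h : z ≤ 0) : relu z = 0 := max_eq_left h

theorem abs_relu_sub_relu_le (y z : ℝ) : |relu y - relu z| ≤ |y - z| := by
  simpa [relu, max_comm] using abs_max_sub_max_le_abs y z 0

/-! ### Heaviside gates from steep ReLUs -/

/-- The indicator of the nonnegative reals. -/
noncomputable def heaviside (s : ℝ) : ℝ := if 0 ≤ s then 1 else 0

/-- A difference of two steep ReLUs eventually equals the Heaviside function at any given point. -/
theorem eventually_relu_sub_relu_eq_heaviside (s : ℝ) :
    ∀ᶠ m : ℕ in atTop, relu (m * s + 1) - relu (m * s) = heaviside s := by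
  by_cases hs : 0 ≤ s
  · refine Eventually.of_forall fun m => ?_
    have : 0 ≤ (m : ℝ) * s := by positivity
    rw [relu_of_nonneg this, relu_of_nonneg (by linarith), heaviside, if_pos hs]
    ring
  · push Not at hs
    obtain ⟨M, hM⟩ := exists_nat_ge (-s)⁻¹
    filter_upwards [eventually_ge_atTop M] with m hm
    have hm' : (-s)⁻¹ ≤ (m : ℝ) := hM.trans (by exact_mod_cast hm)
    have h1 : 1 ≤ (m : ℝ) * (-s) := by
      rwa [inv_eq_one_div, div_le_iff₀ (by linarith)] at hm'
    rw [relu_of_nonpos (by linarith), relu_of_nonpos (by linarith), heaviside, if_neg (by linarith)]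
    ring

/-- `f` agrees, at each point of the nonnegative orthant, with all but finitely many members of a
sequence of ReLU networks of width at most `w`, depth at most `T`, with at most `P` parameters. -/
def EventuallyRealizable (d w T P : ℕ) (f : (Fin d → ℝ) → ℝ) : Prop :=
  ∃ N : ℕ → ReLUNetwork d,
    (∀ m, (N m).depth ≤ T ∧ (N m).width ≤ w ∧ (N m).numParams ≤ P) ∧
      ∀ x, 0 ≤ x → ∀ᶠ m in atTop, (N m).eval x = f x

theorem EventuallyRealizable.mono {d w T P w' T' P' : ℕ} {f : (Fin d → ℝ) → ℝ}
    (h : EventuallyRealizable d w T P f) (hw : w ≤ w') (hT : T ≤ T') (hP : P ≤ P') :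
    EventuallyRealizable d w' T' P' f := by
  obtain ⟨N, h1, h2⟩ := h
  exact ⟨N, fun m => ⟨(h1 m).1.trans hT, (h1 m).2.1.trans hw, (h1 m).2.2.trans hP⟩, h2⟩

theorem EventuallyRealizable.affine {d : ℕ} (W : Matrix (Fin 1) (Fin d) ℝ) (b : Fin 1 → ℝ) :
    EventuallyRealizable d d 1 (d + 1) fun x => (W.mulVec x + b) 0 :=
  ⟨fun _ => .output W b, fun _ => ⟨le_rfl, le_rfl, by simp [ReLUNetwork.numParams]⟩,
    fun _ _ => Eventually.of_forall fun _ => rfl⟩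

theorem EventuallyRealizable.comp_layer {d e w T P : ℕ} {f : (Fin e → ℝ) → ℝ}
    (h : EventuallyRealizable e w T P f) (W : Matrix (Fin e) (Fin d) ℝ) (b : Fin e → ℝ) :
    EventuallyRealizable d (max d w) (T + 1) (P + (e * d + e))
      fun x => f fun i => relu ((W.mulVec x + b) i) := by
  obtain ⟨N, h1, h2⟩ := h
  refine ⟨fun m => .hidden W b (N m), fun m => ⟨?_, ?_, ?_⟩, fun x _ => h2 _ fun i => relu_nonneg _⟩
  · simpa [ReLUNetwork.depth] using (h1 m).1
  · exact max_le_max le_rfl (h1 m).2.1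
  · have := (h1 m).2.2
    simp only [ReLUNetwork.numParams]
    omega

/-! ### Threshold circuits and their conversion to networks -/

/-- A layer that combines ReLU neurons with one Heaviside gate. -/
def IsThresholdStep {w : ℕ} (g : (Fin w → ℝ) → Fin w → ℝ) : Prop :=
  ∃ (W : Matrix (Fin w) (Fin w) ℝ) (b c a : Fin w → ℝ) (t : ℝ),
    ∀ x, g x = fun i => relu ((W.mulVec x + b) i + c i * heaviside (a ⬝ᵥ x + t))

/-- Compositions of a given number of threshold steps. -/
inductive IsThresholdCircuit {w : ℕ} : ℕ → ((Fin w → ℝ) → Fin w → ℝ) → Prop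
  | nil : IsThresholdCircuit 0 id
  | cons {T : ℕ} {g f : (Fin w → ℝ) → Fin w → ℝ} :
      IsThresholdStep g → IsThresholdCircuit T f → IsThresholdCircuit (T + 1) (f ∘ g)

theorem IsThresholdStep.circuit {w : ℕ} {g : (Fin w → ℝ) → Fin w → ℝ} (h : IsThresholdStep g) :
    IsThresholdCircuit 1 g :=
  .cons (f := id) h .nil

theorem IsThresholdCircuit.comp {w T T' : ℕ} {f g : (Fin w → ℝ) → Fin w → ℝ}
    (hg : IsThresholdCircuit T g) (hf : IsThresholdCircuit T' f) :
    IsThresholdCircuit (T' + T) (f ∘ g) := by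
  induction hg with
  | nil => exact hf
  | cons h _ ih =>
    rw [← Function.comp_assoc]
    exact .cons h ih

theorem isThresholdStep_relu {w : ℕ} (W : Matrix (Fin w) (Fin w) ℝ) (b : Fin w → ℝ) :
    IsThresholdStep fun x i => relu ((W.mulVec x + b) i) :=
  ⟨W, b, 0, 0, 0, fun x => by simp⟩

/-- The first layer copies the `d` registers, which `relu` fixes because they are nonnegative, and
adds two steep neurons; the second layer takes their difference as the gate. Equality at `x` needs
`m` large both for the gate at `x` and for `f` at `g x`. -/
theorem EventuallyRealizable.comp_step {d w T P : ℕ} {f : (Fin d → ℝ) → ℝ}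
    (h : EventuallyRealizable d w T P f) {g : (Fin d → ℝ) → Fin d → ℝ} (hg : IsThresholdStep g) :
    EventuallyRealizable d (max (d + 2) w) (T + 2) (P + 2 * (d + 2) * (d + 1)) (f ∘ g) := by
  obtain ⟨N, h1, h2⟩ := h
  obtain ⟨W, b, c, a, t, hg⟩ := hg
  refine ⟨fun m => .hidden
      (Matrix.of (Fin.append (1 : Matrix (Fin d) (Fin d) ℝ) ![(m : ℝ) • a, (m : ℝ) • a]))
      (Fin.append 0 ![(m : ℝ) * t + 1, (m : ℝ) * t])
      (.hidden (Matrix.of fun i => Fin.append (W i) ![c i, -c i]) b (N m)),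
    fun m => ⟨?_, ?_, ?_⟩, fun x hx => ?_⟩
  · simpa [ReLUNetwork.depth] using (h1 m).1
  · have := (h1 m).2.1
    simp only [ReLUNetwork.width]
    omega
  · have := (h1 m).2.2
    simp only [ReLUNetwork.numParams]
    nlinarith
  · have hgx : 0 ≤ g x := by
      rw [hg]
      exact fun i => relu_nonneg _
    filter_upwards [h2 (g x) hgx, eventually_relu_sub_relu_eq_heaviside (a ⬝ᵥ x + t)] with m hm hs
    rw [Function.comp_apply, ← hm, ReLUNetwork.eval, ReLUNetwork.eval]
    congr 1
    rw [hg]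
    funext i
    congr 1
    have hhid : (fun i => relu (((Matrix.of (Fin.append (1 : Matrix (Fin d) (Fin d) ℝ)
        ![(m : ℝ) • a, (m : ℝ) • a])).mulVec x +
          Fin.append (0 : Fin d → ℝ) ![(m : ℝ) * t + 1, (m : ℝ) * t]) i)) =
        Fin.append x ![relu (m * (a ⬝ᵥ x + t) + 1), relu (m * (a ⬝ᵥ x + t))] := by
      funext i
      refine Fin.addCases (fun j => ?_) (fun j => ?_) i
      · have h3 : (1 : Matrix (Fin d) (Fin d) ℝ) j ⬝ᵥ x = x j := congrFun (Matrix.one_mulVec x) j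
        have h4 : (Matrix.of (Fin.append (1 : Matrix (Fin d) (Fin d) ℝ)
            ![(m : ℝ) • a, (m : ℝ) • a])) (Fin.castAdd 2 j) = (1 : Matrix (Fin d) (Fin d) ℝ) j :=
          Fin.append_left _ _ _
        rw [Pi.add_apply, Matrix.mulVec, h4, h3, Fin.append_left, Fin.append_left]
        simpa using relu_of_nonneg (hx j)
      · have h4 : (Matrix.of (Fin.append (1 : Matrix (Fin d) (Fin d) ℝ)
            ![(m : ℝ) • a, (m : ℝ) • a])) (Fin.natAdd d j) = (m : ℝ) • a := by
          refine (Fin.append_right _ _ _).trans ?_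
          fin_cases j <;> rfl
        rw [Pi.add_apply, Matrix.mulVec, h4, smul_dotProduct, Fin.append_right, Fin.append_right]
        fin_cases j <;> simp [mul_add, add_assoc]
    rw [hhid, Pi.add_apply, Pi.add_apply, ← hs]
    simp only [Matrix.mulVec, dotProduct, Matrix.of_apply, Fin.sum_univ_add,
      Fin.append_left, Fin.append_right, Fin.sum_univ_two, Matrix.cons_val_zero,
      Matrix.cons_val_one]
    ring

theorem EventuallyRealizable.comp_circuit {d w T P S : ℕ} {f : (Fin d → ℝ) → ℝ}
    (h : EventuallyRealizable d w T P f) (hw : d + 2 ≤ w) {g : (Fin d → ℝ) → Fin d → ℝ}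
    (hg : IsThresholdCircuit S g) :
    EventuallyRealizable d w (T + 2 * S) (P + S * (2 * (d + 2) * (d + 1))) (f ∘ g) := by
  induction hg with
  | nil => simpa using h
  | cons h1 _ ih =>
    rw [← Function.comp_assoc]
    refine (ih.comp_step h1).mono (by omega) (by omega) (le_of_eq (by ring))

/-! ### Digit arithmetic on five registers -/

/-- Greedy extraction of a `k`-bit digit: if register `R` holds `q * θ + r` with `0 ≤ r < θ`, then
`k` threshold steps replace it by `r` and add `q • u` to the other registers. -/
theorem exists_circuit_extract {w : ℕ} (R : Fin w) (u : Fin w → ℝ) (hu : 0 ≤ u) (huR : u R = 0)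
    {θ : ℝ} (hθ : 0 < θ) (k : ℕ) :
    ∃ g : (Fin w → ℝ) → Fin w → ℝ, IsThresholdCircuit k g ∧
      ∀ x, 0 ≤ x → ∀ q : ℕ, q < 2 ^ k → ∀ r, 0 ≤ r → r < θ → x R = q * θ + r →
        g x = x + (q : ℝ) • (u - Pi.single R θ) := by
  induction k with
  | zero =>
    refine ⟨id, .nil, fun x _ q hq r _ _ _ => ?_⟩
    obtain rfl : q = 0 := by simpa using hq
    simp
  | succ k ih =>
    obtain ⟨g, hg, h⟩ := ih
    -- The step tests the top bit of `q`; if it is set, `v` removes its value from `R` and credits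
    -- it to the other registers.
    set v : Fin w → ℝ := (2 ^ k : ℝ) • (u - Pi.single R θ) with hv
    have hvR : v R = -(2 ^ k * θ) := by simp [hv, huR]
    have hvi : ∀ i, i ≠ R → 0 ≤ v i := fun i hi => by
      have := hu i
      simp only [Pi.zero_apply] at this
      simp [hv, hi, this]
    refine ⟨g ∘ fun x i => relu (x i + v i * heaviside (x R - 2 ^ k * θ)),
      .cons ⟨1, 0, v, Pi.single R 1, -(2 ^ k * θ), fun x => ?_⟩ hg, ?_⟩
    · simp [Matrix.one_mulVec, sub_eq_add_neg]
    · intro x hx q hq r hr hrθ hxR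
      rw [Function.comp_apply]
      by_cases hqk : 2 ^ k ≤ q
      · obtain ⟨q', rfl⟩ := Nat.exists_eq_add_of_le hqk
        have hH : heaviside (x R - 2 ^ k * θ) = 1 := by
          rw [heaviside, if_pos]
          rw [hxR]; push_cast
          have : 0 ≤ (q' : ℝ) * θ := by positivity
          linarith
        have hx' : (fun i => relu (x i + v i * heaviside (x R - 2 ^ k * θ))) = x + v := by
          funext i
          rw [hH, mul_one, Pi.add_apply]
          refine relu_of_nonneg ?_
          by_cases hi : i = R
          · subst hi
            rw [hvR, hxR]; push_cast
            have : 0 ≤ (q' : ℝ) * θ := by positivity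
            linarith
          · exact add_nonneg (hx i) (hvi i hi)
        have hnn : 0 ≤ x + v := by
          rw [← hx']
          exact fun i => relu_nonneg _
        rw [hx', h (x + v) hnn q' (by rw [pow_succ] at hq; omega) r hr hrθ
          (by rw [Pi.add_apply, hvR, hxR]; push_cast; ring), hv]
        push_cast
        rw [add_smul, add_assoc]
      · push Not at hqk
        have hH : heaviside (x R - 2 ^ k * θ) = 0 := by
          rw [heaviside, if_neg]
          rw [hxR]
          have h1 : (q : ℝ) + 1 ≤ 2 ^ k := by exact_mod_cast hqk
          have := mul_le_mul_of_nonneg_right h1 hθ.le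
          linarith
        have hx' : (fun i => relu (x i + v i * heaviside (x R - 2 ^ k * θ))) = x := by
          funext i
          rw [hH, mul_zero, add_zero]
          exact relu_of_nonneg (hx i)
        rw [hx', h x hx q hqk r hr hrθ hxR]

theorem relu_sub_relu_neg (c : ℝ) : relu c - relu (-c) = c := by
  rcases le_total 0 c with h | h
  · rw [relu_of_nonneg h, relu_of_nonpos (by linarith), sub_zero]
  · rw [relu_of_nonpos h, relu_of_nonneg (by linarith)]
    ring

/-- The number with digits `q` in base `2 ^ k`. -/
noncomputable def digitSum (k : ℕ) {m : ℕ} (q : Fin m → ℕ) : ℝ :=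
  ∑ j, (q j : ℝ) * (2 ^ k) ^ (j : ℕ)

theorem digitSum_nonneg (k : ℕ) {m : ℕ} (q : Fin m → ℕ) : 0 ≤ digitSum k q :=
  Finset.sum_nonneg fun _ _ => by positivity

theorem digitSum_succ (k : ℕ) {m : ℕ} (q : Fin (m + 1) → ℕ) :
    digitSum k q = digitSum k (fun j => q j.castSucc) + q (Fin.last m) * (2 ^ k) ^ m := by
  simp [digitSum, Fin.sum_univ_castSucc]

/-- The lower digits and the fractional part stay below the next place value, which is the remainder
condition for extracting the top digit. -/
theorem digitSum_add_lt (k : ℕ) {m : ℕ} (q : Fin m → ℕ) (hq : ∀ j, q j < 2 ^ k) {r : ℝ}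
    (hr : r < 1) : digitSum k q + r < (2 ^ k) ^ m := by
  induction m with
  | zero => simpa [digitSum] using hr
  | succ m ih =>
    have h := ih (fun j => q j.castSucc) fun j => hq _
    have h1 : (q (Fin.last m) : ℝ) + 1 ≤ 2 ^ k := by exact_mod_cast hq (Fin.last m)
    have h2 : (0 : ℝ) < (2 ^ k) ^ m := by positivity
    have h3 := mul_le_mul_of_nonneg_right h1 h2.le
    rw [digitSum_succ, pow_succ ((2 : ℝ) ^ k) m, mul_comm _ ((2 : ℝ) ^ k)]
    linarith

theorem vec5_nonneg {a b c d e : ℝ} (ha : 0 ≤ a) (hb : 0 ≤ b) (hc : 0 ≤ c) (hd : 0 ≤ d)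
    (he : 0 ≤ e) : 0 ≤ ![a, b, c, d, e] := by
  intro i
  fin_cases i <;> assumption

theorem single_one_eq_vec5 (θ : ℝ) : (Pi.single 1 θ : Fin 5 → ℝ) = ![0, θ, 0, 0, 0] := by
  funext i
  fin_cases i <;> simp

/-- Reads the digits stored in register `1` and adds the weighted digit sum, split into its
positive and negative parts, to registers `2` and `3`. -/
theorem exists_circuit_weightedSum (k : ℕ) {m : ℕ} (c : Fin m → ℝ) :
    ∃ g : (Fin 5 → ℝ) → Fin 5 → ℝ, IsThresholdCircuit (m * k) g ∧
      ∀ (q : Fin m → ℕ), (∀ j, q j < 2 ^ k) → ∀ r, 0 ≤ r → r < 1 →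
      ∀ S a b T, 0 ≤ S → 0 ≤ a → 0 ≤ b → 0 ≤ T →
        g ![S, digitSum k q + r, a, b, T] =
          ![S, r, a + ∑ j, relu (c j) * q j, b + ∑ j, relu (-c j) * q j, T] := by
  induction m with
  | zero =>
    refine ⟨id, by simpa using IsThresholdCircuit.nil, fun q _ r _ _ S a b T _ _ _ _ => ?_⟩
    simp [digitSum]
  | succ m ih =>
    obtain ⟨g, hg, h⟩ := ih fun j => c j.castSucc
    obtain ⟨e, he, h'⟩ := exists_circuit_extract (1 : Fin 5)
      ![0, 0, relu (c (Fin.last m)), relu (-c (Fin.last m)), 0]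
      (vec5_nonneg le_rfl le_rfl (relu_nonneg _) (relu_nonneg _) le_rfl) rfl
      (θ := (2 ^ k) ^ m) (by positivity) k
    refine ⟨g ∘ e, by simpa [add_mul] using he.comp hg,
      fun q hq r hr hr1 S a b T hS ha hb hT => ?_⟩
    have hd := digitSum_nonneg k q
    have hd' := digitSum_nonneg k fun j => q j.castSucc
    rw [Function.comp_apply, h' _ (vec5_nonneg hS (by linarith) ha hb hT) (q (Fin.last m)) (hq _)
      (digitSum k (fun j => q j.castSucc) + r) (by linarith)
      (digitSum_add_lt k _ (fun j => hq _) hr1)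
      (by rw [digitSum_succ]; simp only [Matrix.cons_val_one, Matrix.cons_val_zero]; ring)]
    have := h (fun j => q j.castSucc) (fun j => hq _) r hr hr1 S
      (a + relu (c (Fin.last m)) * q (Fin.last m)) (b + relu (-c (Fin.last m)) * q (Fin.last m)) T
      hS (add_nonneg ha (mul_nonneg (relu_nonneg _) (Nat.cast_nonneg _)))
      (add_nonneg hb (mul_nonneg (relu_nonneg _) (Nat.cast_nonneg _))) hT
    convert this using 1
    · congr 1
      funext i
      rw [digitSum_succ, single_one_eq_vec5]
      fin_cases i <;> simp <;> ring
    · funext i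
      fin_cases i <;> simp [Fin.sum_univ_castSucc] <;> ring

/-- Extraction destroys the number it reads, so it works on a copy in register `1` while register
`0` is kept for the next neuron. Registers are nonnegative, hence the signed sum is held as a
difference. -/
theorem exists_circuit_preactivation (k : ℕ) {m : ℕ} (c : Fin m → ℝ) (β : ℝ) :
    ∃ g : (Fin 5 → ℝ) → Fin 5 → ℝ, IsThresholdCircuit (m * k + 1) g ∧
      ∀ (q : Fin m → ℕ), (∀ j, q j < 2 ^ k) → ∀ r, 0 ≤ r → r < 1 → ∀ T, 0 ≤ T →
        ∃ a b, 0 ≤ a ∧ 0 ≤ b ∧ a - b = ∑ j, c j * q j + β ∧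
        g ![digitSum k q + r, 0, 0, 0, T] = ![digitSum k q + r, r, a, b, T] := by
  obtain ⟨g, hg, h⟩ := exists_circuit_weightedSum k c
  -- This layer makes the copy and preloads the positive and negative parts of the bias.
  refine ⟨g ∘ _, (isThresholdStep_relu
    !![1, 0, 0, 0, 0; 1, 0, 0, 0, 0; 0, 0, 0, 0, 0; 0, 0, 0, 0, 0; 0, 0, 0, 0, 1]
    ![0, 0, relu β, relu (-β), 0]).circuit.comp hg, fun q hq r hr hr1 T hT => ?_⟩
  have hS : 0 ≤ digitSum k q + r := add_nonneg (digitSum_nonneg k q) hr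
  refine ⟨relu β + ∑ j, relu (c j) * q j, relu (-β) + ∑ j, relu (-c j) * q j, ?_, ?_, ?_, ?_⟩
  · exact add_nonneg (relu_nonneg _) (Finset.sum_nonneg fun _ _ =>
      mul_nonneg (relu_nonneg _) (Nat.cast_nonneg _))
  · exact add_nonneg (relu_nonneg _) (Finset.sum_nonneg fun _ _ =>
      mul_nonneg (relu_nonneg _) (Nat.cast_nonneg _))
  · rw [add_sub_add_comm, ← Finset.sum_sub_distrib, relu_sub_relu_neg, add_comm]
    simp_rw [← sub_mul, relu_sub_relu_neg]
  · rw [← h q hq r hr hr1 _ _ _ T hS (relu_nonneg β) (relu_nonneg (-β)) hT, Function.comp_apply]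
    congr 1
    funext i
    fin_cases i <;> simp [relu_of_nonneg, hS, hT,
      relu_nonneg]

/-- Computes one neuron from the digits in register `0` and adds the integer part of its value,
scaled by `s`, to register `4`. -/
theorem exists_circuit_neuron (k : ℕ) {m : ℕ} (c : Fin m → ℝ) (β : ℝ) {s : ℝ} (hs : 0 ≤ s) :
    ∃ g : (Fin 5 → ℝ) → Fin 5 → ℝ, IsThresholdCircuit (m * k + k + 3) g ∧
      ∀ (q : Fin m → ℕ), (∀ j, q j < 2 ^ k) → ⌊relu (∑ j, c j * q j + β)⌋₊ < 2 ^ k →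
      ∀ r, 0 ≤ r → r < 1 → ∀ T, 0 ≤ T →
        g ![digitSum k q + r, 0, 0, 0, T] =
          ![digitSum k q + r, 0, 0, 0, T + ⌊relu (∑ j, c j * q j + β)⌋₊ * s] := by
  obtain ⟨g, hg, h⟩ := exists_circuit_preactivation k c β
  obtain ⟨e, he, h'⟩ := exists_circuit_extract (1 : Fin 5) ![0, 0, 0, 0, s]
    (vec5_nonneg le_rfl le_rfl le_rfl le_rfl hs) rfl one_pos k
  -- `h1` forms the activation in register `1`. Extraction with place value `1` then moves its
  -- integer part to register `4`, and `h2` erases the fraction left behind.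
  have h1 := (isThresholdStep_relu
    !![1, 0, 0, 0, 0; 0, 0, 1, -1, 0; 0, 0, 0, 0, 0; 0, 0, 0, 0, 0; 0, 0, 0, 0, 1] 0).circuit
  have h2 := (isThresholdStep_relu
    !![1, 0, 0, 0, 0; 0, 0, 0, 0, 0; 0, 0, 0, 0, 0; 0, 0, 0, 0, 0; 0, 0, 0, 0, 1] 0).circuit
  refine ⟨_, by
    have := ((hg.comp h1).comp he).comp h2
    rwa [show 1 + (k + (1 + (m * k + 1))) = m * k + k + 3 by ring] at this,
    fun q hq hfl r hr hr1 T hT => ?_⟩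
  obtain ⟨a, b, ha, hb, hab, hgx⟩ := h q hq r hr hr1 T hT
  have hS : 0 ≤ digitSum k q + r := add_nonneg (digitSum_nonneg k q) hr
  set y := ∑ j, c j * q j + β
  have hx1 : (fun i => relu ((Matrix.mulVec
      !![1, 0, 0, 0, 0; 0, 0, 1, -1, 0; 0, 0, 0, 0, 0; 0, 0, 0, 0, 0; 0, 0, 0, 0, 1]
      ![digitSum k q + r, r, a, b, T] + 0) i)) = ![digitSum k q + r, relu y, 0, 0, T] := by
    rw [← hab]
    funext i
    fin_cases i <;> simp [relu_of_nonneg, hS, hT,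
      sub_eq_add_neg]
  simp only [Function.comp_apply]
  rw [hgx, hx1, h' _ (vec5_nonneg hS (relu_nonneg _) le_rfl le_rfl hT) _ hfl
    (relu y - ⌊relu y⌋₊) (sub_nonneg.2 (Nat.floor_le (relu_nonneg _)))
    (by linarith [Nat.lt_floor_add_one (relu y)]) (by simp), single_one_eq_vec5]
  have hT' : 0 ≤ T + ⌊relu y⌋₊ * s := by positivity
  funext i
  fin_cases i <;> simp [relu_of_nonneg, hS, hT']

theorem exists_circuit_neurons (k : ℕ) {m m' : ℕ} (c : Fin m' → Fin m → ℝ) (β : Fin m' → ℝ) :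
    ∃ g : (Fin 5 → ℝ) → Fin 5 → ℝ, IsThresholdCircuit (m' * (m * k + k + 3)) g ∧
      ∀ (q : Fin m → ℕ), (∀ j, q j < 2 ^ k) →
      (∀ i, ⌊relu (∑ j, c i j * q j + β i)⌋₊ < 2 ^ k) →
      ∀ r, 0 ≤ r → r < 1 →
        g ![digitSum k q + r, 0, 0, 0, 0] = ![digitSum k q + r, 0, 0, 0,
          digitSum k fun i => ⌊relu (∑ j, c i j * q j + β i)⌋₊] := by
  induction m' with
  | zero =>
    refine ⟨id, by simpa using IsThresholdCircuit.nil, fun q _ _ r _ _ => ?_⟩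
    simp [digitSum]
  | succ m' ih =>
    obtain ⟨g, hg, h⟩ := ih (fun i => c i.castSucc) fun i => β i.castSucc
    obtain ⟨e, he, h'⟩ := exists_circuit_neuron k (c (Fin.last m')) (β (Fin.last m'))
      (s := (2 ^ k) ^ m') (by positivity)
    refine ⟨e ∘ g, by
      have := hg.comp he
      rwa [show m * k + k + 3 + m' * (m * k + k + 3) = (m' + 1) * (m * k + k + 3) by ring] at this,
      fun q hq hfl r hr hr1 => ?_⟩
    rw [Function.comp_apply, h q hq (fun i => hfl _) r hr hr1,
      h' q hq (hfl _) r hr hr1 _ (digitSum_nonneg _ _), digitSum_succ]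

/-- Computes a whole quantized hidden layer, from digits in register `0` to digits in
register `0`. -/
theorem exists_circuit_layer (k : ℕ) {m m' : ℕ} (c : Fin m' → Fin m → ℝ) (β : Fin m' → ℝ) :
    ∃ g : (Fin 5 → ℝ) → Fin 5 → ℝ, IsThresholdCircuit (m' * (m * k + k + 3) + 1) g ∧
      ∀ (q : Fin m → ℕ), (∀ j, q j < 2 ^ k) →
      (∀ i, ⌊relu (∑ j, c i j * q j + β i)⌋₊ < 2 ^ k) →
      ∀ r, 0 ≤ r → r < 1 →
        g ![digitSum k q + r, 0, 0, 0, 0] =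
          ![digitSum k fun i => ⌊relu (∑ j, c i j * q j + β i)⌋₊, 0, 0, 0, 0] := by
  obtain ⟨g, hg, h⟩ := exists_circuit_neurons k c β
  refine ⟨_, by
    have := hg.comp (isThresholdStep_relu
      !![0, 0, 0, 0, 1; 0, 0, 0, 0, 0; 0, 0, 0, 0, 0; 0, 0, 0, 0, 0; 0, 0, 0, 0, 0] 0).circuit
    rwa [add_comm 1] at this,
    fun q hq hfl r hr hr1 => ?_⟩
  rw [Function.comp_apply, h q hq hfl r hr hr1]
  funext i
  fin_cases i <;> simp [relu_of_nonneg,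
    digitSum_nonneg]

/-! ### Lipschitz bound and continuity of networks -/

theorem abs_sum_mul_le {d n : ℕ} (hd : d ≤ n) {B e : ℝ} (hB : 0 ≤ B) (he : 0 ≤ e)
    {w v : Fin d → ℝ} (hw : ∀ j, |w j| ≤ B) (hv : ∀ j, |v j| ≤ e) :
    |∑ j, w j * v j| ≤ n * B * e := by
  calc |∑ j, w j * v j| ≤ ∑ j, |w j * v j| := Finset.abs_sum_le_sum_abs _ _
    _ ≤ ∑ _j : Fin d, B * e := Finset.sum_le_sum fun j _ => by
        rw [abs_mul]
        exact mul_le_mul (hw j) (hv j) (abs_nonneg _) hB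
    _ = d * (B * e) := by simp
    _ ≤ n * (B * e) := by gcongr
    _ = n * B * e := by ring

namespace ReLUNetwork

theorem le_width {d : ℕ} (N : ReLUNetwork d) : d ≤ N.width := by
  cases N with
  | output W b => exact le_rfl
  | hidden W b N => exact le_max_left _ _

theorem one_le_depth {d : ℕ} (N : ReLUNetwork d) : 1 ≤ N.depth := by
  cases N with
  | output W b => exact le_rfl
  | hidden W b N => exact Nat.le_add_left _ _

theorem abs_mulVec_add_sub_le {d m n : ℕ} (hd : d ≤ n) {B e : ℝ} (hB : 0 ≤ B) (he : 0 ≤ e)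
    {W : Matrix (Fin m) (Fin d) ℝ} {b : Fin m → ℝ} (hW : ∀ i j, |W i j| ≤ B) {x y : Fin d → ℝ}
    (hxy : ∀ j, |x j - y j| ≤ e) (i : Fin m) :
    |(W.mulVec x + b) i - (W.mulVec y + b) i| ≤ n * B * e := by
  have : (W.mulVec x + b) i - (W.mulVec y + b) i = ∑ j, W i j * (x j - y j) := by
    simp [Matrix.mulVec, dotProduct, mul_sub]
  rw [this]
  exact abs_sum_mul_le hd hB he (hW i) hxy

/-- Lipschitz continuity with respect to the sup norm. -/
theorem abs_eval_sub_eval_le {n : ℕ} {B : ℝ} (hB : 0 ≤ B) {d : ℕ} (N : ReLUNetwork d)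
    (hw : N.width ≤ n) (hN : N.WeightsBoundedBy B) {e : ℝ} (he : 0 ≤ e) {x y : Fin d → ℝ}
    (hxy : ∀ j, |x j - y j| ≤ e) : |N.eval x - N.eval y| ≤ (n * B) ^ N.depth * e := by
  induction N generalizing e with
  | output W b =>
    rw [eval, eval, depth, pow_one]
    exact abs_mulVec_add_sub_le hw hB he hN.1 hxy 0
  | hidden W b N ih =>
    rw [eval, eval, depth, pow_succ, mul_assoc]
    exact ih ((le_max_right _ _).trans hw) hN.2.2 (by positivity) fun i =>
      (abs_relu_sub_relu_le _ _).trans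
        (abs_mulVec_add_sub_le ((le_max_left _ _).trans hw) hB he hN.1 hxy i)

theorem continuous_eval {d : ℕ} (N : ReLUNetwork d) : Continuous N.eval := by
  induction N with
  | output W b =>
    have : (output W b).eval = fun x => (W.mulVec x + b) 0 := funext fun _ => by rw [eval]
    rw [this]
    fun_prop
  | hidden W b N ih =>
    have : (hidden W b N).eval = fun x => N.eval fun i => max 0 ((W.mulVec x + b) i) :=
      funext fun _ => by rw [eval]; rfl
    rw [this]
    fun_prop

end ReLUNetwork

/-! ### Simulation of the quantized network -/

/-- The bias of a layer acting on digits that encode `δ * q - a`, in units of `δ`. -/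
theorem mulVec_digits {d m : ℕ} (W : Matrix (Fin m) (Fin d) ℝ) (b : Fin m → ℝ) {δ : ℝ} (hδ : δ ≠ 0)
    (a : ℝ) (q : Fin d → ℕ) (i : Fin m) :
    (W.mulVec (fun j => δ * q j - a) + b) i =
      δ * (∑ j, W i j * q j + (b i - a * ∑ j, W i j) / δ) := by
  have h1 : δ * ((b i - a * ∑ j, W i j) / δ) = b i - a * ∑ j, W i j := by field_simp
  rw [mul_add, h1]
  simp only [Matrix.mulVec, dotProduct, Pi.add_apply, mul_sub, Finset.sum_sub_distrib,
    Finset.mul_sum]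
  have h2 : ∀ j, W i j * (δ * (q j : ℝ)) = δ * (W i j * q j) := fun j => by ring
  simp only [h2, mul_comm (W i _) a]
  ring

theorem relu_mul {δ : ℝ} (hδ : 0 ≤ δ) (y : ℝ) : relu (δ * y) = δ * relu y := by
  simp [relu, mul_max_of_nonneg _ _ hδ]

/-- A network is computed up to a small error by threshold circuits on five registers, whose input
is a single number with the digits of all the inputs. -/
theorem exists_realizable_of_network {n k : ℕ} (hn : 1 ≤ n) (hk : 1 ≤ k) {B δ : ℝ} (hB : 1 ≤ B)
    (hδ : 0 < δ) {d : ℕ} (N : ReLUNetwork d) (hw : N.width ≤ n) (hN : N.WeightsBoundedBy B)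
    {H : ℝ} (hH : 1 ≤ H) (a : ℝ) (hHk : H * (2 * n * B) ^ N.depth ≤ 2 ^ k * δ) :
    ∃ F : (Fin 5 → ℝ) → ℝ,
      EventuallyRealizable 5 7 (N.depth * (12 * n ^ 2 * k)) (N.depth * (504 * n ^ 2 * k)) F ∧
      ∀ q : Fin d → ℕ, (∀ j, q j < 2 ^ k) → (∀ j, |δ * q j - a| ≤ H) → ∀ r, 0 ≤ r → r < 1 →
        |F ![digitSum k q + r, 0, 0, 0, 0] - N.eval fun j => δ * q j - a| ≤
          (2 * n * B) ^ N.depth * δ := by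
  have hnR : (1 : ℝ) ≤ n := by exact_mod_cast hn
  have hnB : (1 : ℝ) ≤ n * B := one_le_mul_of_one_le_of_one_le hnR hB
  induction N generalizing H a with
  | @output d W b =>
    have hd : d ≤ n := hw
    obtain ⟨g, hg, h⟩ := exists_circuit_preactivation k (fun j => W 0 j)
      ((b 0 - a * ∑ j, W 0 j) / δ)
    -- The output is not rounded: the last layer returns `δ` times the difference of the two parts,
    -- with no error.
    have hF := (EventuallyRealizable.affine (d := 5) !![0, 0, δ, -δ, 0] 0)
    refine ⟨_, ((hF.mono (by norm_num) le_rfl le_rfl).comp_circuit (w := 7) le_rfl hg).mono le_rfl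
      ?_ ?_, fun q hq _ r hr hr1 => ?_⟩
    · simp only [ReLUNetwork.depth]
      have h1 : d * k ≤ n ^ 2 * k := Nat.mul_le_mul_right _ (by nlinarith)
      have h2 : 1 ≤ n ^ 2 * k := Nat.mul_pos (by positivity) hk
      linarith
    · simp only [ReLUNetwork.depth]
      have h1 : d * k ≤ n ^ 2 * k := Nat.mul_le_mul_right _ (by nlinarith)
      have h2 : 1 ≤ n ^ 2 * k := Nat.mul_pos (by positivity) hk
      linarith
    · obtain ⟨u, v, hu, hv, huv, hgx⟩ := h q hq r hr hr1 0 le_rfl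
      rw [Function.comp_apply, hgx, ReLUNetwork.eval, mulVec_digits W b hδ.ne', ← huv]
      have : ((!![0, 0, δ, -δ, 0] : Matrix (Fin 1) (Fin 5) ℝ).mulVec
          ![digitSum k q + r, r, u, v, 0] + 0) 0 = δ * (u - v) := by
        simp
        ring
      rw [this, sub_self, abs_zero]
      positivity
  | @hidden d m W b N ih =>
    have hd : d ≤ n := (le_max_left _ _).trans hw
    have hw' : N.width ≤ n := (le_max_right _ _).trans hw
    have hm : m ≤ n := N.le_width.trans hw'
    set G : ℝ := 2 * n * B with hG
    have hG2 : 2 ≤ G := by rw [hG]; linarith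
    -- A neuron is at most `nBH + B ≤ 2nBH = HG`, so the range grows by `G` per layer. Hidden values
    -- are nonnegative, so the offset becomes `0`.
    obtain ⟨F, hF, h⟩ := ih hw' hN.2.2 (H := H * G) (by nlinarith) 0
      (by rw [ReLUNetwork.depth, pow_succ] at hHk; linarith)
    obtain ⟨g, hg, h'⟩ := exists_circuit_layer k (fun i j => W i j)
      fun i => (b i - a * ∑ j, W i j) / δ
    refine ⟨_, (hF.comp_circuit le_rfl hg).mono le_rfl ?_ ?_, fun q hq hqH r hr hr1 => ?_⟩
    · simp only [ReLUNetwork.depth]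
      have h1 : m * (d * k + k + 3) ≤ n * (n * k + k + 3) := by gcongr
      -- At most `6n²k` steps per layer, each costing two layers and `2 · 7 · 6 = 84` parameters,
      -- give the constants `12` and `504`.
      have h2 : n * (n * k + k + 3) + 1 ≤ 6 * (n ^ 2 * k) := by
        have h3 : n * k ≤ n ^ 2 * k := Nat.mul_le_mul_right _ (by nlinarith)
        have h4 : n ≤ n ^ 2 * k := by nlinarith
        nlinarith
      linarith
    · simp only [ReLUNetwork.depth]
      have h1 : m * (d * k + k + 3) ≤ n * (n * k + k + 3) := by gcongr
      have h2 : n * (n * k + k + 3) + 1 ≤ 6 * (n ^ 2 * k) := by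
        have h3 : n * k ≤ n ^ 2 * k := Nat.mul_le_mul_right _ (by nlinarith)
        have h4 : n ≤ n ^ 2 * k := by nlinarith
        nlinarith
      linarith
    · set y : Fin m → ℝ := fun i => ∑ j, W i j * q j + (b i - a * ∑ j, W i j) / δ with hy
      have hyx : ∀ i, (W.mulVec (fun j => δ * q j - a) + b) i = δ * y i :=
        mulVec_digits W b hδ.ne' a q
      have hyle : ∀ i, δ * relu (y i) ≤ H * G := fun i => by
        rw [← relu_mul hδ.le, ← hyx, Pi.add_apply]
        have h1 : |W.mulVec (fun j => δ * q j - a) i| ≤ n * B * H :=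
          abs_sum_mul_le hd (by linarith) (by linarith) (hN.1 i) hqH
        have h2 := hN.2.1 i
        have h3 : B ≤ n * B * H := by nlinarith
        have h4 : relu (W.mulVec (fun j => δ * q j - a) i + b i) ≤ n * B * H + B :=
          max_le (by nlinarith) (add_le_add ((le_abs_self _).trans h1) ((le_abs_self _).trans h2))
        rw [hG]
        linarith
      have hfloor : ∀ i, (⌊relu (y i)⌋₊ : ℝ) ≤ relu (y i) := fun i =>
        Nat.floor_le (relu_nonneg _)
      have hfl : ∀ i, ⌊relu (y i)⌋₊ < 2 ^ k := fun i => by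
        have h1 : 2 * (H * G) ≤ 2 ^ k * δ := by
          refine le_trans ?_ hHk
          rw [ReLUNetwork.depth, pow_succ]
          have h2 : 2 ≤ G ^ N.depth := hG2.trans (le_self_pow₀ (by linarith) (by
            have := N.one_le_depth
            omega))
          have h3 : 0 < H * G := by positivity
          nlinarith
        have h2 : relu (y i) < 2 ^ k := by
          have h3 : 0 < H * G := by positivity
          have h4 := hyle i
          by_contra! h5
          have h6 := mul_le_mul_of_nonneg_left h5 hδ.le
          linarith
        have h3 := (hfloor i).trans_lt h2
        exact_mod_cast h3
      have hmain := h (fun i => ⌊relu (y i)⌋₊) hfl (fun i => by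
        rw [sub_zero, abs_of_nonneg (by positivity)]
        exact (mul_le_mul_of_nonneg_left (hfloor i) hδ.le).trans (hyle i)) 0 le_rfl one_pos
      -- Rounding moves each neuron by at most `δ`, which the remaining layers amplify by at most
      -- `(nB) ^ N.depth`. Since `G ≥ 2`, this and the inductive error fit into one more factor `G`.
      have hlip := N.abs_eval_sub_eval_le (by linarith) hw' hN.2.2 hδ.le
        (x := fun i => δ * (⌊relu (y i)⌋₊ : ℝ) - 0)
        (y := fun i => relu ((W.mulVec (fun j => δ * q j - a) + b) i)) fun i => by
          rw [hyx, relu_mul hδ.le, sub_zero, ← mul_sub, abs_mul, abs_of_pos hδ]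
          have h1 := Nat.lt_floor_add_one (relu (y i))
          have h2 : |(⌊relu (y i)⌋₊ : ℝ) - relu (y i)| ≤ 1 := by
            rw [abs_le]
            constructor <;> linarith [hfloor i]
          nlinarith
      rw [Function.comp_apply, h' q hq hfl r hr hr1, ReLUNetwork.eval]
      rw [add_zero] at hmain
      refine (abs_sub_le _ _ _).trans ((add_le_add hmain hlip).trans ?_)
      have hpow : ((n : ℝ) * B) ^ N.depth ≤ G ^ N.depth :=
        pow_le_pow_left₀ (by linarith) (by rw [hG]; linarith) _
      rw [ReLUNetwork.depth, pow_succ, ← add_mul]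
      have h3 : 0 ≤ G ^ N.depth := by positivity
      have : G ^ N.depth + (n * B) ^ N.depth ≤ G ^ N.depth * G := by nlinarith
      exact mul_le_mul_of_nonneg_right this hδ.le

/-! ### Packing the inputs and assembling the narrow network -/

theorem IsThresholdCircuit.nonneg {w T : ℕ} {g : (Fin w → ℝ) → Fin w → ℝ}
    (hg : IsThresholdCircuit T g) {x : Fin w → ℝ} (hx : 0 ≤ x) : 0 ≤ g x := by
  induction hg generalizing x with
  | nil => exact hx
  | cons h _ ih =>
    obtain ⟨W, b, c, a, t, h⟩ := h
    refine ih ?_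
    rw [h]
    exact fun i => relu_nonneg _

/-- Accumulates the integer parts of the registers in `s`, as digits, in register `z`. -/
theorem exists_circuit_encode (k : ℕ) {d : ℕ} (z : Fin d) (s : Finset (Fin d)) (hz : z ∉ s) :
    ∃ g : (Fin d → ℝ) → Fin d → ℝ, IsThresholdCircuit (s.card * k) g ∧
      ∀ x, 0 ≤ x → ∀ q : Fin d → ℕ, (∀ j, q j < 2 ^ k) → ∀ r : Fin d → ℝ, (∀ j, 0 ≤ r j) →
        (∀ j, r j < 1) → (∀ j, x j = q j + r j) →
        g x z = x z + ∑ j ∈ s, (q j : ℝ) * (2 ^ k) ^ (j : ℕ) ∧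
          ∀ j, j ∉ s → j ≠ z → g x j = x j := by
  induction s using Finset.induction_on with
  | empty =>
    exact ⟨id, by simpa using IsThresholdCircuit.nil, fun x _ q _ r _ _ _ => by simp⟩
  | insert i s hi ih =>
    rw [Finset.mem_insert, not_or] at hz
    obtain ⟨g, hg, h⟩ := ih hz.2
    obtain ⟨e, he, h'⟩ := exists_circuit_extract i (Pi.single z ((2 ^ k) ^ (i : ℕ)))
      (Pi.single_nonneg.2 (by positivity)) (Pi.single_eq_of_ne (Ne.symm hz.1) _) one_pos k
    refine ⟨e ∘ g, ?_, fun x hx q hq r hr hr1 hxqr => ?_⟩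
    · rw [Finset.card_insert_of_notMem hi, add_mul, one_mul, add_comm]
      exact hg.comp he
    · obtain ⟨h1, h2⟩ := h x hx q hq r hr hr1 hxqr
      rw [Function.comp_apply, h' (g x) (hg.nonneg hx) (q i) (hq i) (r i) (hr i) (hr1 i)
        (by rw [h2 i hi (Ne.symm hz.1), hxqr, mul_one])]
      refine ⟨?_, fun j hj hjz => ?_⟩
      · rw [Finset.sum_insert hi]
        simp [h1, hz.1]
        ring
      · rw [Finset.mem_insert, not_or] at hj
        simp [hj.1, hjz, h2 j hj.2 hjz]

/-- A first layer of prescribed size rescales the input and makes it nonnegative; the surplus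
neurons are discarded by the second layer. -/
theorem exists_rescale_layers {d w : ℕ} (hdw : d ≤ w) (s t : ℝ) :
    ∃ (W₁ : Matrix (Fin w) (Fin d) ℝ) (b₁ : Fin w → ℝ) (W₂ : Matrix (Fin d) (Fin w) ℝ),
      ∀ x : Fin d → ℝ, (∀ j, 0 ≤ s * x j + t) →
        (fun j => relu ((W₂.mulVec (fun i => relu ((W₁.mulVec x + b₁) i)) + 0) j)) =
          fun j => s * x j + t := by
  refine ⟨Matrix.of fun i => fun j => if j.castLE hdw = i then s else 0, fun _ => t,
    Matrix.of fun j => Pi.single (j.castLE hdw) 1, fun x hx => ?_⟩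
  funext j
  have h1 : (fun l => if l = j then s else 0) ⬝ᵥ x = s * x j := by
    simp [dotProduct]
  simp [Matrix.mulVec_apply, h1, relu_of_nonneg (hx j)]

/-- A sequence of narrow networks which, at each point of the cube, are eventually close to a given
network. -/
theorem exists_narrow_networks {n k A d : ℕ} (hA : 0 < A) (hd : 0 < d) (hk : 1 ≤ k) {B δ : ℝ}
    (hB : 1 ≤ B) (hδ : 0 < δ) (N₀ : ReLUNetwork d) (hw : N₀.width ≤ n)
    (hN : N₀.WeightsBoundedBy B) (hAk : 2 * A * (2 * n * B) ^ N₀.depth ≤ 2 ^ k * δ) :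
    ∃ N : ℕ → ReLUNetwork d,
      (∀ m, (N m).width = max (d + 2) 10 ∧ (N m).depth ≤ 17 * (n ^ 2 * N₀.depth * k) ∧
        (N m).numParams ≤ 504 * (n ^ 2 * N₀.depth * k) + 53 * (d ^ 3 * k)) ∧
      ∀ x ∈ cube d A, ∀ᶠ m in atTop,
        |(N m).eval x - N₀.eval x| ≤ 2 * (2 * n * B) ^ N₀.depth * δ := by
  have hdn : d ≤ n := N₀.le_width.trans hw
  have hn : 1 ≤ n := hd.trans_le hdn
  have hnR : (1 : ℝ) ≤ n := by exact_mod_cast hn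
  have hnB : (1 : ℝ) ≤ n * B := one_le_mul_of_one_le_of_one_le hnR hB
  have hAR : (1 : ℝ) ≤ A := by exact_mod_cast hA
  have hL := N₀.one_le_depth
  set L := N₀.depth with hLdef
  set G : ℝ := 2 * n * B with hG
  have hG2 : 2 ≤ G := by rw [hG]; linarith
  have hGL : 2 ≤ G ^ L := hG2.trans (le_self_pow₀ (by linarith) (by omega))
  obtain ⟨F, hF, hFN⟩ := exists_realizable_of_network hn hk hB hδ N₀ hw hN hAR A (by
    have : 0 ≤ (A : ℝ) * G ^ L := by positivity
    rw [← hLdef, ← hG]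
    linarith)
  -- Coordinate `0` has place value `1`, so its register already holds its own digit and can collect
  -- the others. Its fractional part remains, which is why the simulation tolerates a remainder `r`.
  set z : Fin d := ⟨0, hd⟩
  obtain ⟨g, hg, hgx⟩ := exists_circuit_encode k z (Finset.univ.erase z) (by simp)
  have hcard : (Finset.univ.erase z).card ≤ d := by simp
  -- The layer between the two circuits passes the packed number to register `0` of the
  -- five-register machine and clears the rest.
  obtain ⟨N, hNm, hNx⟩ := ((hF.comp_layer (Matrix.of ![Pi.single z 1, 0, 0, 0, 0]) 0).mono
    (w' := max (d + 2) 10) (by omega) le_rfl le_rfl).comp_circuit (le_max_left _ _) hg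
  have hdw : d ≤ max (d + 2) 10 := by omega
  obtain ⟨W₁, b₁, W₂, hW⟩ := exists_rescale_layers hdw δ⁻¹ (δ⁻¹ * A)
  refine ⟨fun m => .hidden W₁ b₁ (.hidden W₂ 0 (N m)), fun m => ⟨?_, ?_, ?_⟩, fun x hx => ?_⟩
  · have := (hNm m).2.1
    simp only [ReLUNetwork.width]
    omega
  -- `17 = 12 + 2 + 3`: simulation, packing, and three extra layers.
  · have h1 := (hNm m).1
    have h2 : (Finset.univ.erase z).card * k ≤ d * k := Nat.mul_le_mul_right _ hcard
    have h3 : d * k ≤ n ^ 2 * L * k := Nat.mul_le_mul_right _ (by nlinarith)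
    have h4 : 1 ≤ n ^ 2 * L * k := Nat.mul_pos (Nat.mul_pos (by positivity) hL) hk
    simp only [ReLUNetwork.depth]
    linarith
  -- `53 = 12 + 20 + 16 + 5`: packing costs `12d³k`, the three extra layers at most `20d² + 16d +
  -- 5`.
  · have h1 := (hNm m).2.2
    have h2 : (Finset.univ.erase z).card * k * (2 * (d + 2) * (d + 1)) ≤ d * k * (12 * d ^ 2) :=
      Nat.mul_le_mul (Nat.mul_le_mul_right _ hcard) (by nlinarith)
    have h3 : max (d + 2) 10 ≤ 10 * d := by omega
    have h4 : max (d + 2) 10 * d ≤ 10 * d * d := Nat.mul_le_mul_right _ h3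
    have h5 : d ^ 2 ≤ d ^ 3 * k := by
      calc d ^ 2 = d ^ 2 * 1 := by ring
        _ ≤ d ^ 2 * (d * k) := Nat.mul_le_mul_left _ (Nat.mul_pos hd hk)
        _ = d ^ 3 * k := by ring
    have h6 : d ≤ d ^ 2 := by nlinarith
    simp only [ReLUNetwork.numParams]
    nlinarith
  · have hyA : ∀ j, 0 ≤ x j + A ∧ x j + A ≤ 2 * A := fun j => by
      have := hx j
      rw [Set.mem_Icc] at this
      constructor <;> linarith
    set y : Fin d → ℝ := fun j => δ⁻¹ * x j + δ⁻¹ * A with hy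
    have hδy : ∀ j, δ * y j = x j + A := fun j => by
      simp only [hy]
      field_simp
    have hy0 : 0 ≤ y := fun j => by
      simp only [hy, ← mul_add, Pi.zero_apply]
      exact mul_nonneg (inv_nonneg.2 hδ.le) (hyA j).1
    set q : Fin d → ℕ := fun j => ⌊y j⌋₊ with hq
    have hfloor : ∀ j, (q j : ℝ) ≤ y j := fun j => Nat.floor_le (hy0 j)
    have hfloor' : ∀ j, y j < q j + 1 := fun j => Nat.lt_floor_add_one _
    have hq2 : ∀ j, q j < 2 ^ k := fun j => by
      have h1 : y j < 2 ^ k := by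
        have h4 := hδy j
        have h7 := hyA j
        by_contra! h5
        have h6 := mul_le_mul_of_nonneg_left h5 hδ.le
        nlinarith
      exact_mod_cast (hfloor j).trans_lt h1
    have hδq : ∀ j, δ * q j - A ≤ x j ∧ x j ≤ δ * q j - A + δ := fun j => by
      have h1 := mul_le_mul_of_nonneg_left (hfloor j) hδ.le
      have h2 := mul_le_mul_of_nonneg_left (hfloor' j).le hδ.le
      have h3 := hδy j
      constructor <;> linarith
    obtain ⟨hgz, -⟩ := hgx y hy0 q hq2 (fun j => y j - q j) (fun j => sub_nonneg.2 (hfloor j))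
      (fun j => by linarith [hfloor' j]) (fun j => by ring)
    have hS : g y z = digitSum k q + (y z - q z) := by
      rw [hgz, digitSum, ← Finset.add_sum_erase _ _ (Finset.mem_univ z)]
      simp [z]
      ring
    have hmain := hFN q hq2 (fun j => by
      have h1 := hδq j
      have h2 := hx j
      have h3 : 0 ≤ δ * q j := by positivity
      rw [Set.mem_Icc] at h2
      rw [abs_le]
      constructor <;> linarith) (y z - q z) (sub_nonneg.2 (hfloor z)) (by linarith [hfloor' z])
    have hlip := N₀.abs_eval_sub_eval_le (by linarith) hw hN hδ.le
      (x := fun j => δ * q j - A) (y := x) fun j => by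
        have := hδq j
        rw [abs_le]
        constructor <;> linarith
    filter_upwards [hNx y hy0] with m hm
    have hgn : 0 ≤ g y z := hg.nonneg hy0 z
    have hvec : (fun i => relu (((Matrix.of ![Pi.single z 1, 0, 0, 0, 0]).mulVec (g y) + 0) i)) =
        ![digitSum k q + (y z - q z), 0, 0, 0, 0] := by
      rw [← hS]
      funext i
      fin_cases i <;> simp [relu_of_nonneg, hgn]
    rw [ReLUNetwork.eval, ReLUNetwork.eval, hW x hy0, hm, Function.comp_apply, hvec]
    refine (abs_sub_le _ _ _).trans ((add_le_add hmain hlip).trans ?_)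
    have hpow : ((n : ℝ) * B) ^ L ≤ G ^ L :=
      pow_le_pow_left₀ (by linarith) (by rw [hG]; linarith) _
    rw [← hLdef, ← hG, two_mul, add_mul]
    exact add_le_add_right (mul_le_mul_of_nonneg_right hpow hδ.le) _

/-! ### Choice of the steepness and of the number of bits -/

/-- A property that holds eventually almost everywhere on a probability space holds, from some
index on, with probability arbitrarily close to one. -/
theorem eventually_lt_measureReal_of_ae_eventually {α : Type*} [MeasurableSpace α] {D : Measure α}
    [IsProbabilityMeasure D] {E : ℕ → Set α} (hE : ∀ m, MeasurableSet (E m))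
    (h : ∀ᵐ x ∂D, ∀ᶠ m in atTop, x ∈ E m) {δ : ℝ} (hδ : 0 < δ) :
    ∀ᶠ m in atTop, 1 - δ < D.real (E m) := by
  have h1 : Tendsto (fun m => D (E m)) atTop (nhds (D Set.univ)) :=
    tendsto_measure_of_ae_tendsto_indicator_of_isFiniteMeasure atTop MeasurableSet.univ hE
      (h.mono fun x hx => hx.mono fun m hm => by simp [hm])
  have h2 : Tendsto (fun m => D.real (E m)) atTop (nhds 1) := by
    have := (ENNReal.tendsto_toReal (measure_ne_top D Set.univ)).comp h1
    simpa [measureReal_def, Function.comp_def] using this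
  exact h2.eventually_const_lt (by linarith)

theorem measurableSet_cube (d : ℕ) (A : ℝ) : MeasurableSet (cube d A) := by
  have : cube d A = Set.univ.pi fun _ => Set.Icc (-A) A := by
    ext x
    simp only [cube, Set.mem_ofPred_eq, Set.mem_univ_pi]
  rw [this]
  exact MeasurableSet.univ_pi fun _ => measurableSet_Icc

theorem HasDensityBoundedBy.ae_mem_cube {d : ℕ} {D : Measure (Fin d → ℝ)} {A β : ℝ}
    (h : HasDensityBoundedBy D A β) : ∀ᵐ x ∂D, x ∈ cube d A := by
  obtain ⟨-, p, -, -, rfl⟩ := h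
  exact (withDensity_absolutelyContinuous _ _).ae_le (ae_restrict_mem (measurableSet_cube d A))

/-- The number of bits needed for a prescribed accuracy. -/
theorem exists_numBits {A n L : ℕ} {B ε : ℝ} (hA : 0 < A) (hn : 0 < n) (hL : 0 < L)
    (hB : 1 ≤ B) (hε : 0 < ε) (hε2 : ε ≤ 1 / 2) :
    ∃ k : ℕ, 1 ≤ k ∧ 4 * A * ((2 * n * B) ^ L) ^ 2 / ε ≤ 2 ^ k ∧
      (k : ℝ) ≤ 8 * (L * Real.logb 2 (A * B * n / ε)) ∧ 1 ≤ Real.logb 2 (A * B * n / ε) := by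
  have hAR : (1 : ℝ) ≤ A := by exact_mod_cast hA
  have hnR : (1 : ℝ) ≤ n := by exact_mod_cast hn
  have hLR : (1 : ℝ) ≤ L := by exact_mod_cast hL
  have hlA : 0 ≤ Real.logb 2 (A : ℝ) := Real.logb_nonneg one_lt_two hAR
  have hln : 0 ≤ Real.logb 2 (n : ℝ) := Real.logb_nonneg one_lt_two hnR
  have hlB : 0 ≤ Real.logb 2 B := Real.logb_nonneg one_lt_two hB
  have hlε : Real.logb 2 ε ≤ -1 := by
    rw [Real.logb_le_iff_le_rpow one_lt_two hε, Real.rpow_neg_one]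
    linarith
  have hΛ : Real.logb 2 (A * B * n / ε) =
      Real.logb 2 A + Real.logb 2 B + Real.logb 2 n - Real.logb 2 ε := by
    rw [Real.logb_div (by positivity) hε.ne', Real.logb_mul (by positivity) (by positivity),
      Real.logb_mul (by positivity) (by positivity)]
  -- With `G = (2nB)^L`, the mesh `ε / (2G)` makes the error `2G` times the mesh equal to `ε`. The
  -- range condition `2AG ≤ 2 ^ k * (mesh)` then brings in a second factor `G`.
  set X : ℝ := 4 * A * ((2 * n * B) ^ L) ^ 2 / ε with hX
  have hX0 : 0 < X := by positivity
  have hlX : Real.logb 2 X = 2 + Real.logb 2 A +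
      2 * (L * (1 + Real.logb 2 n + Real.logb 2 B)) - Real.logb 2 ε := by
    have h4 : Real.logb 2 4 = 2 := by
      rw [show (4 : ℝ) = 2 ^ 2 by norm_num, Real.logb_pow, Real.logb_self_eq_one one_lt_two]
      norm_num
    rw [hX, Real.logb_div (by positivity) hε.ne', Real.logb_mul (by positivity) (by positivity),
      Real.logb_mul (by positivity) (by positivity), Real.logb_pow, Real.logb_pow,
      Real.logb_mul (by positivity) (by positivity), Real.logb_mul (by positivity) (by positivity),
      h4, Real.logb_self_eq_one one_lt_two]
    norm_num
  have hlX0 : 0 < Real.logb 2 X := by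
    rw [hlX]
    have : 0 ≤ (L : ℝ) * (1 + Real.logb 2 n + Real.logb 2 B) := by positivity
    linarith
  refine ⟨⌈Real.logb 2 X⌉₊, Nat.ceil_pos.2 hlX0, ?_, ?_, ?_⟩
  · rw [← Real.rpow_natCast, ← Real.logb_le_iff_le_rpow one_lt_two hX0]
    exact Nat.le_ceil _
  · have h1 := (Nat.ceil_lt_add_one hlX0.le).le
    rw [hΛ]
    rw [hlX] at h1 ⊢
    -- The additive terms `3 + 2L` are absorbed by `-log₂ ε ≥ 1`, which comes from `ε ≤ 1/2`.
    nlinarith [mul_nonneg (sub_nonneg.2 hLR) hlA, mul_nonneg (sub_nonneg.2 hLR) hln,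
      mul_nonneg (sub_nonneg.2 hLR) hlB,
      mul_nonneg (sub_nonneg.2 hLR) (by linarith : 0 ≤ -1 - Real.logb 2 ε)]
  · rw [hΛ]
    linarith

theorem theorem4p1 :
    ∃ C : ℝ, 0 < C ∧
      ∀ (A B n L d : ℕ) (ε δ β : ℝ), 0 < A → 0 < B → 0 < d → 0 < ε → 0 < δ → 0 < β →
      ∀ N₀ : ReLUNetwork d, N₀.width = n → N₀.depth = L → N₀.WeightsBoundedBy (B : ℝ) →
      ∀ D : Measure (Fin d → ℝ), HasDensityBoundedBy D (A : ℝ) β →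
      ∃ N : ReLUNetwork d,
        N.width = max (d + 2) 10 ∧
        (N.depth : ℝ) ≤
          C * ((n : ℝ) ^ 2 * (L : ℝ) ^ 2 *
            Real.logb 2 ((A : ℝ) * (B : ℝ) * (n : ℝ) / min ε (1 / 2))) ∧
        1 - δ < D.real {x | |N.eval x - N₀.eval x| ≤ ε} ∧
        (N.numParams : ℝ) ≤
          C * ((d : ℝ) * (n : ℝ) ^ 2 * (L : ℝ) ^ 2 *
            Real.logb 2 ((A : ℝ) * (B : ℝ) * (n : ℝ) / min ε (1 / 2)) ^ 2) ∧
        ((d : ℝ) ^ (3 / 2 : ℝ) ≤ (n : ℝ) →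
          (N.numParams : ℝ) ≤
            C * ((n : ℝ) ^ 2 * (L : ℝ) ^ 2 *
              Real.logb 2 ((A : ℝ) * (B : ℝ) * (n : ℝ) / min ε (1 / 2)) ^ 2)) := by
  -- The parameter count needs `8 · (504 + 53) = 4456`, the depth only `8 · 17`; the `8` comes from
  -- `k ≤ 8LΛ`.
  refine ⟨5000, by norm_num, fun A B n L d ε δ β hA hB hd hε hδ _ N₀ hwidth hdepth hN D hD => ?_⟩
  have hprob : IsProbabilityMeasure D := hD.1
  have hdn : d ≤ n := hwidth ▸ N₀.le_width
  have hL : 0 < L := hdepth ▸ N₀.one_le_depth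
  have hn : 0 < n := hd.trans_le hdn
  have hBR : (1 : ℝ) ≤ B := by exact_mod_cast hB
  set ε' := min ε (1 / 2) with hε'
  have hε'0 : 0 < ε' := lt_min hε (by norm_num)
  obtain ⟨k, hk, hk2, hkle, hΛ⟩ := exists_numBits hA hn hL hBR hε'0 (min_le_right _ _)
  set Λ := Real.logb 2 ((A : ℝ) * B * n / ε')
  set G : ℝ := (2 * n * B) ^ L with hG
  have hG0 : 0 < G := by positivity
  obtain ⟨N, hNm, hNx⟩ := exists_narrow_networks hA hd hk hBR (δ := ε' / (2 * G)) (by positivity)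
    N₀ hwidth.le hN (by
      rw [hdepth, ← hG]
      rw [div_le_iff₀ hε'0] at hk2
      rw [← mul_div_assoc, le_div_iff₀ (by positivity)]
      linarith)
  rw [hdepth, ← hG] at hNx
  have hacc : 2 * G * (ε' / (2 * G)) = ε' := by field_simp
  obtain ⟨m, hm⟩ := (eventually_lt_measureReal_of_ae_eventually (D := D)
    (E := fun m => {x | |(N m).eval x - N₀.eval x| ≤ ε})
    (fun m => (isClosed_le (((N m).continuous_eval.sub N₀.continuous_eval).abs)
      continuous_const).measurableSet)
    (hD.ae_mem_cube.mono fun x hx => (hNx x hx).mono fun m hm => by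
      rw [hacc] at hm
      exact hm.trans (min_le_left _ _)) hδ).exists
  obtain ⟨h1, h2, h3⟩ := hNm m
  rw [hdepth] at h2 h3
  have h2' : ((N m).depth : ℝ) ≤ 17 * (n ^ 2 * L * k) := by exact_mod_cast h2
  have h3' : ((N m).numParams : ℝ) ≤ 504 * (n ^ 2 * L * k) + 53 * (d ^ 3 * k) := by
    exact_mod_cast h3
  have hdR : (1 : ℝ) ≤ d := by exact_mod_cast hd
  have hLR : (1 : ℝ) ≤ L := by exact_mod_cast hL
  have hdnR : (d : ℝ) ≤ n := by exact_mod_cast hdn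
  have hkn : (n : ℝ) ^ 2 * L * k ≤ 8 * (n ^ 2 * L ^ 2 * Λ) := by
    have := mul_le_mul_of_nonneg_left hkle (by positivity : (0 : ℝ) ≤ n ^ 2 * L)
    linarith
  have hΛΛ : Λ ≤ Λ ^ 2 := by nlinarith
  have hnLΛ : (n : ℝ) ^ 2 * L ^ 2 * Λ ≤ n ^ 2 * L ^ 2 * Λ ^ 2 := by gcongr
  -- Both parameter bounds have this form, with `K = dn²` and `K = n²`; the hypothesis `d^{1.5} ≤ n`
  -- is what gives `d³ ≤ n²` in the second.
  have hparams : ∀ K : ℝ, (n : ℝ) ^ 2 ≤ K → (d : ℝ) ^ 3 ≤ K →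
      ((N m).numParams : ℝ) ≤ 5000 * (K * L ^ 2 * Λ ^ 2) := fun K hnK hdK => by
    have hK : 0 ≤ K := (by positivity : (0 : ℝ) ≤ n ^ 2).trans hnK
    have hk' : (k : ℝ) ≤ 8 * (L ^ 2 * Λ ^ 2) := by
      refine hkle.trans (mul_le_mul_of_nonneg_left ?_ (by norm_num))
      exact mul_le_mul (by nlinarith) hΛΛ (by linarith) (by positivity)
    have h4 : (d : ℝ) ^ 3 * k ≤ K * (8 * (L ^ 2 * Λ ^ 2)) :=
      mul_le_mul hdK hk' (by positivity) hK
    have h5 : (n : ℝ) ^ 2 * (L ^ 2 * Λ ^ 2) ≤ K * (L ^ 2 * Λ ^ 2) :=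
      mul_le_mul_of_nonneg_right hnK (by positivity)
    have h6 : 0 ≤ K * (L ^ 2 * Λ ^ 2) := by positivity
    linarith
  refine ⟨N m, h1, ?_, hm, ?_, fun hdn' => ?_⟩
  · have : 0 ≤ (n : ℝ) ^ 2 * L ^ 2 * Λ := by positivity
    linarith
  · exact hparams _ (le_mul_of_one_le_left (by positivity) hdR) (by
      rw [pow_succ']
      gcongr)
  · refine hparams _ le_rfl ?_
    have h4 := pow_le_pow_left₀ (by positivity) hdn' 2
    rw [← Real.rpow_natCast, ← Real.rpow_mul (by positivity)] at h4
    norm_num at h4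
    exact_mod_cast h4
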